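/- Let $\mathcal H$ be a complex Hilbert space with an orthonormal basis $(e_n)_{n\in\mathbb Z}$, let $(\omega_n)_{n\in\mathbb Z}$ be a bounded sequence of positive real numbers, and let $S$ be the bilateral weighted shift on $\mathcal H$ given by $Se_n=\omega_ne_{n+1}$ for all $n\in\mathbb Z$. Put $\beta_n=\omega_0\cdots\omega_{n-1}$ for $n>0$, $\beta_0=1$, and $\beta_n=\frac{1}{\omega_n\cdots\omega_{-1}}$ for $n<0$, and $$r_2^-(S)=\liminf_{n\to+\infty}\Big[\frac{1}{\beta_{-n}}\Big]^{1/n},\qquad r_3^+(S)=\limsup_{n\to+\infty}\,[\beta_n]^{1/n}.$$ For a non-zero $x=\sum_{n\in\mathbb Z}a_ne_n\in\mathcal H$ put $$R_\omega^+(x)=\liminf_{n\to+\infty}\Big|\frac{\beta_n}{a_n}\Big|^{1/n}\in[0,+\infty],$$ where $|\beta_n/a_n|=+\infty$ if $a_n=0$. The local spectrum $\sigma_S(x)$ is the complement in $\mathbb C$ of the union of all open sets $U\subset\mathbb C$ for which there is an analytic function $f:U\to\mathcal H$ with $(S-\lambda)f(\lambda)=x$ for all $\lambda\in U$. Assume that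 $r_2^-(S)=0$, and let $k\in\mathbb Z$. Then for every non-zero $x$ in the closed linear span of $\{e_n:n\geq k\}$ the following statements hold. (a) If $r_3^+(S)<R_\omega^+(x)$, then $\sigma_S(x)=\{\lambda\in\mathbb C:|\lambda|\leq r_3^+(S)\}$. (b) If $r_3^+(S)\geq R_\omega^+(x)$, then $\{\lambda\in\mathbb C:|\lambda|\leq R_\omega^+(x)\}\subset\sigma_S(x)$. -/

import Mathlib

open scoped ENNReal

/-- The local resolvent set of `T` at `x`: the union of all open sets `U` of complex numbers on
which the equation `(T - z) f(z) = x` has an analytic solution `f`. -/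
def localResolventSet {H : Type*} [NormedAddCommGroup H] [NormedSpace ℂ H]
    (T : H →L[ℂ] H) (x : H) : Set ℂ :=
  ⋃₀ {U : Set ℂ | IsOpen U ∧
    ∃ f : ℂ → H, AnalyticOnNhd ℂ f U ∧ ∀ z ∈ U, T (f z) - z • f z = x}

/-- The local spectrum of `T` at `x`. -/
def localSpectrum {H : Type*} [NormedAddCommGroup H] [NormedSpace ℂ H]
    (T : H →L[ℂ] H) (x : H) : Set ℂ :=
  (localResolventSet T x)ᶜ

/-- `S` is the bilateral weighted shift with the positive bounded weight sequence `ω`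
with respect to the orthonormal basis `e`: `S eₙ = ωₙ eₙ₊₁` for all integers `n`. -/
structure IsBilateralWeightedShift {H : Type*} [NormedAddCommGroup H] [InnerProductSpace ℂ H]
    (e : HilbertBasis ℤ ℂ H) (ω : ℤ → ℝ) (S : H →L[ℂ] H) : Prop where
  weight_pos : ∀ n, 0 < ω n
  weight_bdd : BddAbove (Set.range ω)
  apply_basis : ∀ n, S (e n) = (ω n : ℂ) • e (n + 1)

namespace BilateralShift

/-- `βₙ = ω₀ ⋯ ωₙ₋₁` for `n ≥ 0` (so `β₀ = 1`) and `βₙ = 1 / (ωₙ ⋯ ω₋₁)` for `n < 0`. -/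
noncomputable def beta (ω : ℤ → ℝ) (n : ℤ) : ℝ :=
  if 0 ≤ n then ∏ i ∈ Finset.Ico 0 n, ω i else 1 / ∏ i ∈ Finset.Ico n 0, ω i

/-- `r₂⁻ = liminf (1 / β₋ₙ) ^ (1 / n)` as `n → +∞`, in `[0, ∞]`. -/
noncomputable def r2Minus (ω : ℤ → ℝ) : ℝ≥0∞ :=
  Filter.liminf (fun n : ℕ => ENNReal.ofReal (1 / beta ω (-(n : ℤ))) ^ (1 / (n : ℝ))) Filter.atTop

/-- `r₃⁺ = limsup βₙ ^ (1 / n)` as `n → +∞`, in `[0, ∞]`. -/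
noncomputable def r3Plus (ω : ℤ → ℝ) : ℝ≥0∞ :=
  Filter.limsup (fun n : ℕ => ENNReal.ofReal (beta ω n) ^ (1 / (n : ℝ))) Filter.atTop

/-- `R⁺(x) = liminf (βₙ / |aₙ|) ^ (1 / n)` as `n → +∞`, in `[0, ∞]`, where `aₙ` are the
coordinates of `x` in the basis `e`. The quotient is taken in `[0, ∞]`: it is `∞` if `aₙ = 0`. -/
noncomputable def RPlus {H : Type*} [NormedAddCommGroup H] [InnerProductSpace ℂ H]
    (e : HilbertBasis ℤ ℂ H) (ω : ℤ → ℝ) (x : H) : ℝ≥0∞ :=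
  Filter.liminf
    (fun n : ℕ => (ENNReal.ofReal (beta ω n) / ‖e.repr x (n : ℤ)‖ₑ) ^ (1 / (n : ℝ))) Filter.atTop

/-- The closed linear span of `{eₙ : n ≥ k}`. -/
def HPlus {H : Type*} [NormedAddCommGroup H] [InnerProductSpace ℂ H]
    (e : HilbertBasis ℤ ℂ H) (k : ℤ) : Submodule ℂ H :=
  (Submodule.span ℂ (e '' Set.Ici k)).topologicalClosure

end BilateralShift

/-
Write `x̂(n) = aₙ / βₙ`. In these coordinates `S` is multiplication by `ζ` on formal Laurent series,
so `S y - z y = x` reads `ŷ(n) - z ŷ(n + 1) = x̂(n + 1)`, and the sequence `zⁿ ŷ(n)` telescopes.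

If `r₃⁺ < p < R⁺(x)`, then `‖Sⁿ x‖ ≤ C pⁿ`, so the Neumann series `-∑ w⁻ⁿ⁻¹ Sⁿ x` is a local
resolvent on `|w| > p`. This bounds the local spectrum from above.

Conversely, let `f` be a local resolvent near a point `z` with `r₂⁻ ≤ |z| ≤ min (r₃⁺) (R⁺(x))`, and
let `m + 1` be the index of the first non-zero coordinate of `x`. For `|w| > r₂⁻` and `y = f(w)`,
the sequence `wⁿ ŷ(n)` is constant for `n ≤ m` and clusters at `0` at `-∞`, so `ŷ(m) = 0`; by the
identity theorem `ŷ(m)` vanishes for all `w` near `z`. For `0 < |w| < min (r₃⁺) (R⁺(x))` it clusters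
at `0` at `+∞`, so telescoping gives `∑ x̂(m + 1 + i) wⁱ = ŷ(m) = 0`, and the identity theorem for
this power series yields `x̂(m + 1) = 0`, a contradiction. When `z = 0`, the equation at `z` already
reads `x̂(m + 1) = ŷ(m) = 0`.
-/

open Filter Topology
open scoped NNReal

section SequenceGrowth

theorem rpow_one_div_natCast_lt_iff {a t : ℝ≥0∞} {n : ℕ} (hn : 0 < n) :
    a ^ (1 / (n : ℝ)) < t ↔ a < t ^ n := by
  rw [one_div, ENNReal.rpow_inv_lt_iff (Nat.cast_pos.2 hn), ENNReal.rpow_natCast]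

theorem lt_rpow_one_div_natCast_iff {a t : ℝ≥0∞} {n : ℕ} (hn : 0 < n) :
    t < a ^ (1 / (n : ℝ)) ↔ t ^ n < a := by
  rw [one_div, ENNReal.lt_rpow_inv_iff (Nat.cast_pos.2 hn), ENNReal.rpow_natCast]

variable {a : ℕ → ℝ≥0∞} {t : ℝ≥0∞}

theorem eventually_lt_pow_of_limsup_root_lt
    (h : limsup (fun n : ℕ => a n ^ (1 / (n : ℝ))) atTop < t) : ∀ᶠ n in atTop, a n < t ^ n := by
  filter_upwards [eventually_lt_of_limsup_lt h, eventually_gt_atTop 0] with n han hn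
  exact (rpow_one_div_natCast_lt_iff hn).1 han

theorem frequently_pow_lt_of_lt_limsup_root
    (h : t < limsup (fun n : ℕ => a n ^ (1 / (n : ℝ))) atTop) : ∃ᶠ n in atTop, t ^ n < a n :=
  ((frequently_lt_of_lt_limsup (by isBoundedDefault) h).and_eventually
    (eventually_gt_atTop 0)).mono fun _ ⟨han, hn⟩ => (lt_rpow_one_div_natCast_iff hn).1 han

theorem frequently_lt_pow_of_liminf_root_lt
    (h : liminf (fun n : ℕ => a n ^ (1 / (n : ℝ))) atTop < t) : ∃ᶠ n in atTop, a n < t ^ n :=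
  ((frequently_lt_of_liminf_lt (by isBoundedDefault) h).and_eventually
    (eventually_gt_atTop 0)).mono fun _ ⟨han, hn⟩ => (rpow_one_div_natCast_lt_iff hn).1 han

theorem eventually_pow_lt_of_lt_liminf_root
    (h : t < liminf (fun n : ℕ => a n ^ (1 / (n : ℝ))) atTop) : ∀ᶠ n in atTop, t ^ n < a n := by
  filter_upwards [eventually_lt_of_lt_liminf h, eventually_gt_atTop 0] with n han hn
  exact (lt_rpow_one_div_natCast_iff hn).1 han

theorem map_add_natCast_atTop (k : ℤ) : map (fun i : ℕ => k + (i : ℤ)) atTop = atTop := by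
  rw [← (OrderIso.addLeft k).map_atTop, ← Nat.map_cast_int_atTop, map_map]
  rfl

theorem exists_norm_add_natCast_le_mul_pow {E : Type*} [SeminormedAddCommGroup E] {u : ℤ → E}
    {r : ℝ} (hr : 0 < r) (h : ∀ᶠ n in atTop, ‖u n‖ ≤ r ^ n) (k : ℤ) :
    ∃ C, 0 < C ∧ ∀ i : ℕ, ‖u (k + i)‖ ≤ C * r ^ i := by
  have hO : (fun i : ℕ => u (k + i)) =O[atTop] fun i : ℕ => r ^ i := by
    rw [← map_add_natCast_atTop k, eventually_map] at h
    refine .of_bound (r ^ k) (h.mono fun i hi => hi.trans_eq ?_)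
    rw [zpow_add₀ hr.ne', zpow_natCast, Real.norm_of_nonneg (by positivity)]
  obtain ⟨C, hC, hbound⟩ := Asymptotics.bound_of_isBigO_nat_atTop hO
  refine ⟨C, hC, fun i => (hbound (by positivity)).trans_eq ?_⟩
  rw [Real.norm_of_nonneg (by positivity)]

end SequenceGrowth

section ClusterPoints

variable {ι X E : Type*} {L : Filter ι}

theorem eq_of_mapClusterPt_of_tendsto [TopologicalSpace X] [T2Space X] {u : ι → X} {a b : X}
    (ha : MapClusterPt a L u) (hb : Tendsto u L (𝓝 b)) : a = b :=
  have : NeBot (𝓝 a ⊓ 𝓝 b) := ha.clusterPt.mono hb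
  eq_of_nhds_neBot this

theorem mapClusterPt_zero_of_frequently_norm_le [SeminormedAddCommGroup E] {u : ι → E} {v : ι → ℝ}
    (h : ∃ᶠ n in L, ‖u n‖ ≤ v n) (hv : Tendsto v L (𝓝 0)) : MapClusterPt 0 L u := by
  refine Metric.nhds_basis_ball.mapClusterPt_iff_frequently.2 fun ε hε => ?_
  refine (h.and_eventually (hv.eventually_lt_const hε)).mono fun n ⟨hun, hvn⟩ => ?_
  exact mem_ball_zero_iff.2 (hun.trans_lt hvn)

end ClusterPoints

section LocalSpectrum

variable {E : Type*} [NormedAddCommGroup E] [NormedSpace ℂ E] {T : E →L[ℂ] E} {x : E}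

theorem resolvent_equation_of_hasSum {w : ℂ} (hw : w ≠ 0) {y : E}
    (hy : HasSum (fun n : ℕ => w⁻¹ ^ n • (T ^ n) x) y) :
    T (-w⁻¹ • y) - w • (-w⁻¹ • y) = x := by
  have htail : HasSum (fun n : ℕ => w⁻¹ ^ (n + 1) • (T ^ (n + 1)) x) (y - x) := by
    simpa using (hasSum_nat_add_iff' 1).2 hy
  have hTy : w⁻¹ • T y = y - x := by
    refine HasSum.unique ?_ htail
    simpa [pow_succ', smul_smul] using (hy.mapL T).const_smul w⁻¹
  rw [map_smul, neg_smul, hTy, smul_smul, mul_neg, mul_inv_cancel₀ hw]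
  module

theorem notMem_localSpectrum_of_norm_pow_apply_le [CompleteSpace E] {C r : ℝ} (hr : 0 ≤ r)
    (h : ∀ n, ‖(T ^ n) x‖ ≤ C * r ^ n) {z : ℂ} (hz : r < ‖z‖) : z ∉ localSpectrum T x := by
  obtain ⟨s, hrs, hsz⟩ := exists_between hz
  have hs : 0 < s := hr.trans_lt hrs
  set U : Set ℂ := {w | s < ‖w‖}
  have hU : IsOpen U := isOpen_lt continuous_const continuous_norm
  have hU0 : ∀ w ∈ U, w ≠ 0 := fun w hw => norm_pos_iff.1 (hs.trans hw)
  have hinv : DifferentiableOn ℂ (fun w : ℂ => w⁻¹) U := differentiableOn_inv.mono hU0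
  have hbound : ∀ n : ℕ, ∀ w ∈ U, ‖w⁻¹ ^ n • (T ^ n) x‖ ≤ C * (r / s) ^ n := fun n w hw => by
    have hws : ‖w⁻¹‖ ≤ s⁻¹ := by
      rw [norm_inv]
      exact inv_anti₀ hs (le_of_lt hw)
    calc ‖w⁻¹ ^ n • (T ^ n) x‖ = ‖w⁻¹‖ ^ n * ‖(T ^ n) x‖ := by rw [norm_smul, norm_pow]
      _ ≤ s⁻¹ ^ n * (C * r ^ n) := by gcongr; exact h n
      _ = C * (r / s) ^ n := by rw [div_eq_mul_inv, mul_pow]; ring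
  have hsummable : Summable fun n : ℕ => C * (r / s) ^ n :=
    (summable_geometric_of_lt_one (by positivity) ((div_lt_one hs).2 hrs)).mul_left C
  have hdiff : DifferentiableOn ℂ (fun w => -w⁻¹ • ∑' n : ℕ, w⁻¹ ^ n • (T ^ n) x) U :=
    hinv.neg.smul (Complex.differentiableOn_tsum_of_summable_norm hsummable
      (fun n => (hinv.pow n).smul_const _) hU hbound)
  exact fun hmem => hmem ⟨U, ⟨hU, _, hdiff.analyticOnNhd hU, fun w hw =>
    resolvent_equation_of_hasSum (hU0 w hw)
      (Summable.of_norm_bounded hsummable fun n => hbound n w hw).hasSum⟩, hsz⟩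

end LocalSpectrum

namespace BilateralShift

section Beta

variable {ω : ℤ → ℝ} {ρ : ℝ≥0}

theorem beta_pos (hω : ∀ n, 0 < ω n) (n : ℤ) : 0 < beta ω n := by
  unfold beta
  split_ifs
  · exact Finset.prod_pos fun i _ => hω i
  · exact one_div_pos.2 (Finset.prod_pos fun i _ => hω i)

theorem beta_add_one {n : ℤ} (hn : ω n ≠ 0) : beta ω (n + 1) = ω n * beta ω n := by
  rcases lt_trichotomy n (-1) with h | rfl | h
  · rw [beta, beta, if_neg (by lia), if_neg (by lia),
      ← Finset.insert_Ico_add_one_left_eq_Ico (by lia : n < 0), Finset.prod_insert (by simp)]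
    field_simp
  · rw [beta, beta, if_pos (by lia), if_neg (by lia),
      ← Finset.insert_Ico_add_one_left_eq_Ico (by lia : (-1 : ℤ) < 0)]
    simp [hn]
  · rw [beta, beta, if_pos (by lia), if_pos (by lia),
      ← Finset.insert_Ico_right_eq_Ico_add_one (by lia : 0 ≤ n), Finset.prod_insert (by simp)]

theorem eventually_beta_lt_zpow (hω : ∀ n, 0 < ω n) (h : r3Plus ω < ρ) :
    ∀ᶠ n in atTop, beta ω n < (ρ : ℝ) ^ n := by
  rw [← Nat.map_cast_int_atTop, eventually_map]
  filter_upwards [eventually_lt_pow_of_limsup_root_lt h] with n hn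
  rw [← ENNReal.coe_pow, ENNReal.ofReal_lt_coe_iff (beta_pos hω n).le] at hn
  exact_mod_cast hn

theorem frequently_zpow_lt_beta_atTop (h : ρ < r3Plus ω) :
    ∃ᶠ n in atTop, (ρ : ℝ) ^ n < beta ω n := by
  rw [← Nat.map_cast_int_atTop, frequently_map]
  refine (frequently_pow_lt_of_lt_limsup_root h).mono fun n hn => ?_
  rw [← ENNReal.coe_pow, ENNReal.coe_lt_ofReal] at hn
  exact_mod_cast hn

theorem frequently_zpow_lt_beta_atBot (hω : ∀ n, 0 < ω n) (h : r2Minus ω < ρ) :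
    ∃ᶠ n in atBot, (ρ : ℝ) ^ n < beta ω n := by
  have hρ : (0 : ℝ) < ρ := by exact_mod_cast pos_of_gt h
  have hneg : Tendsto (fun n : ℕ => -(n : ℤ)) atTop atBot :=
    tendsto_neg_atTop_atBot.comp tendsto_natCast_atTop_atTop
  refine hneg.frequently ((frequently_lt_pow_of_liminf_root_lt h).mono fun n hn => ?_)
  have hβ := beta_pos hω (-n)
  rw [← ENNReal.coe_pow, ENNReal.ofReal_lt_coe_iff (by positivity), NNReal.coe_pow,
    one_div_lt hβ (by positivity)] at hn
  rwa [zpow_neg, zpow_natCast, ← one_div]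

end Beta

section LaurentCoeff

variable {H : Type*} [NormedAddCommGroup H] [InnerProductSpace ℂ H]
  {e : HilbertBasis ℤ ℂ H} {ω : ℤ → ℝ} {x y : H} {k m n : ℤ} {ρ : ℝ≥0} {z : ℂ}

/-- The functional `x ↦ aₙ / βₙ`, where `aₙ` is the `n`-th coordinate of `x`. In these coordinates
`x` is the formal Laurent series `∑ (aₙ / βₙ) ζⁿ` and the weighted shift becomes multiplication by
the variable `ζ`. -/
noncomputable def laurentCoeff (e : HilbertBasis ℤ ℂ H) (ω : ℤ → ℝ) (n : ℤ) : H →L[ℂ] ℂ :=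
  (beta ω n : ℂ)⁻¹ • innerSL ℂ (e n)

theorem laurentCoeff_apply (e : HilbertBasis ℤ ℂ H) (ω : ℤ → ℝ) (n : ℤ) (x : H) :
    laurentCoeff e ω n x = e.repr x n / beta ω n := by
  simp [laurentCoeff, e.repr_apply_apply, div_eq_inv_mul]

theorem laurentCoeff_eq_zero_iff (hω : ∀ n, 0 < ω n) :
    laurentCoeff e ω n x = 0 ↔ e.repr x n = 0 := by
  simp [laurentCoeff_apply, (beta_pos hω n).ne']

theorem norm_laurentCoeff_apply (hω : ∀ n, 0 < ω n) :
    ‖laurentCoeff e ω n x‖ = ‖e.repr x n‖ / beta ω n := by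
  rw [laurentCoeff_apply, norm_div, Complex.norm_real, Real.norm_of_nonneg (beta_pos hω n).le]

theorem norm_laurentCoeff_apply_le (hω : ∀ n, 0 < ω n) :
    ‖laurentCoeff e ω n x‖ ≤ ‖x‖ / beta ω n := by
  have hβ := beta_pos hω n
  rw [norm_laurentCoeff_apply hω, e.repr_apply_apply]
  gcongr
  simpa [e.orthonormal.norm_eq_one] using norm_inner_le_norm (𝕜 := ℂ) (e n) x

theorem laurentCoeff_basis_of_ne (h : n ≠ m) : laurentCoeff e ω n (e m) = 0 := by
  simp [laurentCoeff, e.orthonormal.2 h]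

theorem laurentCoeff_eq_zero_of_mem_HPlus (hx : x ∈ HPlus e k) (hn : n < k) :
    laurentCoeff e ω n x = 0 := by
  have hspan : Submodule.span ℂ (e '' Set.Ici k) ≤ (laurentCoeff e ω n).ker := by
    rw [Submodule.span_le]
    rintro _ ⟨m, hm, rfl⟩
    exact laurentCoeff_basis_of_ne (hn.trans_le hm).ne
  exact Submodule.topologicalClosure_minimal _ hspan (laurentCoeff e ω n).isClosed_ker hx

theorem exists_first_laurentCoeff_ne_zero (hω : ∀ n, 0 < ω n) (hx : x ∈ HPlus e k) (hx0 : x ≠ 0) :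
    ∃ m, (∀ n ≤ m, laurentCoeff e ω n x = 0) ∧ laurentCoeff e ω (m + 1) x ≠ 0 := by
  have hne : ∃ n, laurentCoeff e ω n x ≠ 0 := by
    by_contra! h
    refine hx0 (e.repr.map_eq_zero_iff.1 (lp.ext (funext fun n => ?_)))
    exact (laurentCoeff_eq_zero_iff hω).1 (h n)
  have hbdd : ∀ n, laurentCoeff e ω n x ≠ 0 → k ≤ n := fun n hn =>
    not_lt.1 fun hnk => hn (laurentCoeff_eq_zero_of_mem_HPlus hx hnk)
  obtain ⟨l, hl, hmin⟩ := Int.exists_least_of_bdd ⟨k, hbdd⟩ hne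
  refine ⟨l - 1, fun n hn => ?_, by rwa [sub_add_cancel]⟩
  by_contra h
  linarith [hmin n h]

theorem eventually_norm_laurentCoeff_le (hω : ∀ n, 0 < ω n) (hρ : 0 < ρ) (h : ρ < RPlus e ω x) :
    ∀ᶠ n in atTop, ‖laurentCoeff e ω n x‖ ≤ (ρ : ℝ)⁻¹ ^ n := by
  rw [← Nat.map_cast_int_atTop, eventually_map]
  filter_upwards [eventually_pow_lt_of_lt_liminf_root h] with n hn
  have hle : (ρ : ℝ) ^ n * ‖e.repr x n‖ ≤ beta ω n := by
    have := ENNReal.mul_le_of_le_div hn.le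
    rw [← ENNReal.coe_pow, enorm_eq_nnnorm, ← ENNReal.coe_mul,
      ← ENNReal.ofReal_coe_nnreal, ENNReal.ofReal_le_ofReal_iff (beta_pos hω n).le] at this
    exact_mod_cast this
  rw [norm_laurentCoeff_apply hω, zpow_natCast, inv_pow, div_le_iff₀ (beta_pos hω n),
    inv_mul_eq_div, le_div_iff₀' (by positivity)]
  exact hle

/-- The power series `∑ᵢ x̂(k + i) ζⁱ` built from the coefficients `x̂(n)` of `x` from index `k`
onwards. -/
noncomputable def tailSeries (e : HilbertBasis ℤ ℂ H) (ω : ℤ → ℝ) (x : H) (k : ℤ) :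
    FormalMultilinearSeries ℂ ℂ ℂ :=
  .ofScalars ℂ fun i : ℕ => laurentCoeff e ω (k + i) x

theorem RPlus_le_radius_tailSeries (hω : ∀ n, 0 < ω n) (x : H) (k : ℤ) :
    RPlus e ω x ≤ (tailSeries e ω x k).radius := by
  refine ENNReal.le_of_forall_nnreal_lt fun ρ hρ => ?_
  rcases eq_zero_or_pos ρ with rfl | hρ0
  · simp
  have hρ' : (0 : ℝ) < ρ := hρ0
  obtain ⟨C, -, hC⟩ := exists_norm_add_natCast_le_mul_pow (inv_pos.2 hρ')
    (eventually_norm_laurentCoeff_le hω hρ0 hρ) k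
  refine FormalMultilinearSeries.le_radius_of_bound _ C fun i => ?_
  rw [tailSeries, FormalMultilinearSeries.ofScalars_norm, ← le_div_iff₀ (by positivity),
    div_eq_mul_inv, ← inv_pow]
  exact hC i

theorem hasSum_tailSeries (hω : ∀ n, 0 < ω n) (k : ℤ) (hz : ‖z‖ₑ < RPlus e ω x) :
    HasSum (fun i : ℕ => laurentCoeff e ω (k + i) x * z ^ i) ((tailSeries e ω x k).sum z) := by
  have hmem : z ∈ Metric.eball (0 : ℂ) (tailSeries e ω x k).radius := by
    rw [mem_eball_zero_iff]
    exact hz.trans_le (RPlus_le_radius_tailSeries hω x k)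
  simpa [tailSeries, mul_comm] using (tailSeries e ω x k).hasSum hmem

theorem laurentCoeff_eq_zero_of_tailSeries_eventuallyEq_zero (hω : ∀ n, 0 < ω n)
    (hz : ‖z‖ₑ < RPlus e ω x) (h : (tailSeries e ω x k).sum =ᶠ[𝓝 z] 0) :
    laurentCoeff e ω k x = 0 := by
  have hzr := hz.trans_le (RPlus_le_radius_tailSeries hω x k)
  have hF := (tailSeries e ω x k).hasFPowerSeriesOnBall (pos_of_gt hzr)
  have h0 := hF.analyticOnNhd.eqOn_zero_of_preconnected_of_eventuallyEq_zero
    Metric.isPreconnected_eball (mem_eball_zero_iff.2 hzr) h (Metric.mem_eball_self hF.r_pos)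
  simpa [tailSeries] using (hF.coeff_zero fun _ => 0).trans h0

theorem hasSum_laurentCoeff_smul (hω : ∀ n, 0 < ω n) (hx : x ∈ HPlus e k) :
    HasSum (fun i : ℕ => laurentCoeff e ω (k + i) x • (beta ω (k + i) : ℂ) • e (k + i)) x := by
  have hinj : Function.Injective fun i : ℕ => k + (i : ℤ) := fun i j h => by simpa using h
  have hterm : ∀ n, laurentCoeff e ω n x • (beta ω n : ℂ) • e n = e.repr x n • e n := fun n => by
    have hβ : (beta ω n : ℂ) ≠ 0 := Complex.ofReal_ne_zero.2 (beta_pos hω n).ne'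
    rw [smul_smul, laurentCoeff_apply, div_mul_cancel₀ _ hβ]
  refine (hinj.hasSum_iff (f := fun n => laurentCoeff e ω n x • (beta ω n : ℂ) • e n)
    fun n hn => ?_).2 (by simpa only [hterm] using e.hasSum_repr x)
  have hnk : n < k := not_le.1 fun hkn => hn ⟨(n - k).toNat, by dsimp only; lia⟩
  rw [laurentCoeff_eq_zero_of_mem_HPlus hx hnk, zero_smul]

theorem mapClusterPt_zpow_mul_laurentCoeff {L : Filter ℤ} (hω : ∀ n, 0 < ω n) (hρ : 0 < ρ)
    (hβ : ∃ᶠ n in L, (ρ : ℝ) ^ n < beta ω n)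
    (hL : Tendsto (fun n : ℤ => (‖z‖ / ρ) ^ n) L (𝓝 0)) (y : H) :
    MapClusterPt 0 L fun n => z ^ n * laurentCoeff e ω n y := by
  refine mapClusterPt_zero_of_frequently_norm_le (v := fun n : ℤ => (‖z‖ / ρ) ^ n * ‖y‖)
    (hβ.mono fun n hn => ?_) (by simpa using hL.mul_const ‖y‖)
  calc ‖z ^ n * laurentCoeff e ω n y‖ = ‖z‖ ^ n * ‖laurentCoeff e ω n y‖ := by
        rw [norm_mul, norm_zpow]
    _ ≤ ‖z‖ ^ n * (‖y‖ / ρ ^ n) := by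
        gcongr
        exact (norm_laurentCoeff_apply_le hω).trans (by gcongr)
    _ = (‖z‖ / ρ) ^ n * ‖y‖ := by rw [div_zpow]; ring

theorem mapClusterPt_zpow_mul_laurentCoeff_atTop (hω : ∀ n, 0 < ω n) (hz : ‖z‖ₑ < r3Plus ω)
    (y : H) : MapClusterPt 0 atTop fun n => z ^ n * laurentCoeff e ω n y := by
  obtain ⟨ρ, hzρ, hρ⟩ := ENNReal.lt_iff_exists_nnreal_btwn.1 hz
  have hρ0 : 0 < ρ := ENNReal.coe_pos.1 (pos_of_gt hzρ)
  have hlt : ‖z‖ / ρ < 1 := (div_lt_one (NNReal.coe_pos.2 hρ0)).2 (enorm_lt_coe.1 hzρ)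
  refine mapClusterPt_zpow_mul_laurentCoeff hω hρ0 (frequently_zpow_lt_beta_atTop hρ) ?_ y
  rw [← Nat.map_cast_int_atTop, tendsto_map'_iff]
  simpa [Function.comp_def] using tendsto_pow_atTop_nhds_zero_of_lt_one (by positivity) hlt

theorem mapClusterPt_zpow_mul_laurentCoeff_atBot (hω : ∀ n, 0 < ω n) (hz : r2Minus ω < ‖z‖ₑ)
    (y : H) : MapClusterPt 0 atBot fun n => z ^ n * laurentCoeff e ω n y := by
  obtain ⟨ρ, hρ, hρz⟩ := ENNReal.lt_iff_exists_nnreal_btwn.1 hz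
  have hρ0 : 0 < ρ := ENNReal.coe_pos.1 (pos_of_gt hρ)
  have hlt : ρ < ‖z‖₊ := ENNReal.coe_lt_coe.1 hρz
  have hlt' : ρ / ‖z‖ < 1 := (div_lt_one (hρ0.trans hlt)).2 hlt
  refine mapClusterPt_zpow_mul_laurentCoeff hω hρ0 (frequently_zpow_lt_beta_atBot hω hρ) ?_ y
  rw [← map_neg_atTop, ← Nat.map_cast_int_atTop, map_map, tendsto_map'_iff]
  refine (tendsto_pow_atTop_nhds_zero_of_lt_one (by positivity) hlt').congr fun n => ?_
  simp only [Function.comp_apply, zpow_neg, zpow_natCast, ← inv_pow, inv_div]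

end LaurentCoeff

end BilateralShift

namespace IsBilateralWeightedShift

open BilateralShift

variable {H : Type*} [NormedAddCommGroup H] [InnerProductSpace ℂ H]
  {e : HilbertBasis ℤ ℂ H} {ω : ℤ → ℝ} {S : H →L[ℂ] H} {x y : H} {k m : ℤ} {z : ℂ}

theorem beta_add_one (hS : IsBilateralWeightedShift e ω S) (n : ℤ) :
    (beta ω (n + 1) : ℂ) = ω n * beta ω n := by
  rw [BilateralShift.beta_add_one (hS.weight_pos n).ne', Complex.ofReal_mul]

theorem laurentCoeff_add_one_apply (hS : IsBilateralWeightedShift e ω S) (n : ℤ) (y : H) :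
    laurentCoeff e ω (n + 1) (S y) = laurentCoeff e ω n y := by
  have hω : (ω n : ℂ) ≠ 0 := Complex.ofReal_ne_zero.2 (hS.weight_pos n).ne'
  have hbasis : Set.EqOn (laurentCoeff e ω (n + 1) ∘L S) (laurentCoeff e ω n) (Set.range e) := by
    rintro _ ⟨j, rfl⟩
    rw [ContinuousLinearMap.comp_apply, hS.apply_basis, map_smul]
    rcases eq_or_ne n j with rfl | hnj
    · simp only [laurentCoeff, hS.beta_add_one, smul_apply, innerSL_apply_apply,
        inner_self_eq_norm_sq_to_K, e.orthonormal.norm_eq_one, smul_eq_mul]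
      field_simp
    · rw [laurentCoeff_basis_of_ne hnj, laurentCoeff_basis_of_ne (by simpa using hnj), smul_zero]
  exact DFunLike.congr_fun (ContinuousLinearMap.ext_on
    (Submodule.dense_iff_topologicalClosure_eq_top.2 e.dense_span) hbasis) y

theorem pow_apply_beta_smul_basis (hS : IsBilateralWeightedShift e ω S) (j : ℤ) (n : ℕ) :
    (S ^ n) ((beta ω j : ℂ) • e j) = (beta ω (j + n) : ℂ) • e (j + n) := by
  induction n with
  | zero => simp
  | succ n ih =>
    rw [pow_succ', mul_apply_eq_comp, ih, map_smul, hS.apply_basis, smul_smul, mul_comm,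
      ← hS.beta_add_one, Nat.cast_succ, add_assoc]

theorem exists_norm_pow_apply_le (hS : IsBilateralWeightedShift e ω S) (hx : x ∈ HPlus e k)
    {p : ℝ≥0} (hp : r3Plus ω < p) (hpR : p < RPlus e ω x) :
    ∃ C, ∀ n, ‖(S ^ n) x‖ ≤ C * (p : ℝ) ^ n := by
  obtain ⟨q, hpq, hqR⟩ := ENNReal.lt_iff_exists_nnreal_btwn.1 hpR
  have hβ := beta_pos hS.weight_pos
  have hp0 : (0 : ℝ) < p := by exact_mod_cast pos_of_gt hp
  have hpq' : (p : ℝ) < q := by exact_mod_cast hpq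
  have hq0 : (0 : ℝ) < q := hp0.trans hpq'
  obtain ⟨C, hC, hcoeff⟩ := exists_norm_add_natCast_le_mul_pow (inv_pos.2 hq0)
    (eventually_norm_laurentCoeff_le hS.weight_pos hq0 hqR) k
  obtain ⟨D, -, hbeta⟩ := exists_norm_add_natCast_le_mul_pow (u := beta ω) hp0
    ((eventually_beta_lt_zpow hS.weight_pos hp).mono fun n hn => by
      simpa [abs_of_pos (hβ n)] using hn.le) k
  have hgeom := hasSum_geometric_of_lt_one (by positivity) ((div_lt_one hq0).2 hpq')
  refine ⟨C * D * (1 - p / q : ℝ)⁻¹, fun n => ?_⟩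
  have hbound : ∀ i : ℕ,
      ‖(S ^ n) (laurentCoeff e ω (k + i) x • (beta ω (k + i) : ℂ) • e (k + i))‖ ≤
        C * D * (p : ℝ) ^ n * (p / q : ℝ) ^ i := fun i => by
    rw [map_smul, hS.pow_apply_beta_smul_basis, norm_smul, norm_smul, e.orthonormal.norm_eq_one,
      mul_one, Complex.norm_real, add_assoc, ← Nat.cast_add]
    calc _ ≤ C * (q : ℝ)⁻¹ ^ i * (D * (p : ℝ) ^ (i + n)) :=
          mul_le_mul (hcoeff i) (hbeta (i + n)) (norm_nonneg _) (by positivity)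
      _ = C * D * (p : ℝ) ^ n * (p / q : ℝ) ^ i := by rw [div_eq_mul_inv, mul_pow, pow_add]; ring
  calc ‖(S ^ n) x‖ ≤ C * D * (p : ℝ) ^ n * (1 - p / q : ℝ)⁻¹ :=
        ((hasSum_laurentCoeff_smul hS.weight_pos hx).mapL (S ^ n)).norm_le_of_bounded
          (hgeom.mul_left _) hbound
    _ = C * D * (1 - p / q : ℝ)⁻¹ * (p : ℝ) ^ n := by ring

theorem localSpectrum_subset_of_r3Plus_lt_RPlus [CompleteSpace H]
    (hS : IsBilateralWeightedShift e ω S) (hx : x ∈ HPlus e k) (h : r3Plus ω < RPlus e ω x) :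
    localSpectrum S x ⊆ {z : ℂ | ‖z‖ₑ ≤ r3Plus ω} := by
  intro z hz
  by_contra! hlt
  obtain ⟨p, hp, hpmin⟩ := ENNReal.lt_iff_exists_nnreal_btwn.1 (lt_min h (not_le.1 hlt))
  obtain ⟨C, hC⟩ := hS.exists_norm_pow_apply_le hx hp (hpmin.trans_le (min_le_left _ _))
  have hpz : p < ‖z‖₊ := ENNReal.coe_lt_coe.1 (hpmin.trans_le (min_le_right _ _))
  exact notMem_localSpectrum_of_norm_pow_apply_le p.coe_nonneg hC hpz hz

theorem laurentCoeff_sub_mul_laurentCoeff_add_one (hS : IsBilateralWeightedShift e ω S)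
    (h : S y - z • y = x) (n : ℤ) :
    laurentCoeff e ω n y - z * laurentCoeff e ω (n + 1) y = laurentCoeff e ω (n + 1) x := by
  rw [← h, map_sub, map_smul, hS.laurentCoeff_add_one_apply, smul_eq_mul]

theorem zpow_mul_sum_laurentCoeff (hS : IsBilateralWeightedShift e ω S) (hz : z ≠ 0)
    (h : S y - z • y = x) (n : ℤ) (j : ℕ) :
    z ^ n * ∑ i ∈ Finset.range j, laurentCoeff e ω (n + 1 + i) x * z ^ i =
      z ^ n * laurentCoeff e ω n y - z ^ (n + j) * laurentCoeff e ω (n + j) y := by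
  induction j with
  | zero => simp
  | succ j ih =>
    rw [Finset.sum_range_succ, mul_add, ih, add_right_comm,
      ← hS.laurentCoeff_sub_mul_laurentCoeff_add_one h, Nat.cast_succ, ← add_assoc,
      zpow_add_one₀ hz, zpow_add₀ hz, zpow_natCast]
    ring

theorem laurentCoeff_eq_zero_of_r2Minus_lt (hS : IsBilateralWeightedShift e ω S)
    (hx : ∀ n ≤ m, laurentCoeff e ω n x = 0) (hz : r2Minus ω < ‖z‖ₑ) (h : S y - z • y = x) :
    laurentCoeff e ω m y = 0 := by
  have hz0 : z ≠ 0 := enorm_pos.1 (pos_of_gt hz)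
  have hconst : ∀ᶠ n in atBot, z ^ n * laurentCoeff e ω n y = z ^ m * laurentCoeff e ω m y := by
    filter_upwards [eventually_le_atBot m] with n hn
    obtain ⟨j, rfl⟩ := Int.le.dest hn
    rw [← sub_eq_zero, ← hS.zpow_mul_sum_laurentCoeff hz0 h,
      Finset.sum_eq_zero fun i hi => ?_, mul_zero]
    rw [hx _ (by have := Finset.mem_range.1 hi; lia), zero_mul]
  have hzero := eq_of_mapClusterPt_of_tendsto
    (mapClusterPt_zpow_mul_laurentCoeff_atBot hS.weight_pos hz y)
    (tendsto_const_nhds.congr' (hconst.mono fun n hn => hn.symm))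
  exact (mul_eq_zero.1 hzero.symm).resolve_left (zpow_ne_zero _ hz0)

theorem tailSeries_sum_eq (hS : IsBilateralWeightedShift e ω S) (hz : z ≠ 0)
    (hz3 : ‖z‖ₑ < r3Plus ω) (hzR : ‖z‖ₑ < RPlus e ω x) (h : S y - z • y = x) (n : ℤ) :
    (tailSeries e ω x (n + 1)).sum z = laurentCoeff e ω n y := by
  have hpartial : Tendsto (fun j : ℕ => z ^ (n + j) * laurentCoeff e ω (n + j) y) atTop
      (𝓝 (z ^ n * laurentCoeff e ω n y - z ^ n * (tailSeries e ω x (n + 1)).sum z)) := by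
    refine (((hasSum_tailSeries hS.weight_pos (n + 1) hzR).tendsto_sum_nat.const_mul
      (z ^ n)).const_sub (z ^ n * laurentCoeff e ω n y)).congr fun j => ?_
    rw [hS.zpow_mul_sum_laurentCoeff hz h, sub_sub_cancel]
  have hlim : Tendsto (fun j => z ^ j * laurentCoeff e ω j y) atTop
      (𝓝 (z ^ n * laurentCoeff e ω n y - z ^ n * (tailSeries e ω x (n + 1)).sum z)) := by
    rwa [← map_add_natCast_atTop n, tendsto_map'_iff]
  have hzero := eq_of_mapClusterPt_of_tendsto
    (mapClusterPt_zpow_mul_laurentCoeff_atTop hS.weight_pos hz3 y) hlim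
  exact (mul_left_cancel₀ (zpow_ne_zero n hz) (sub_eq_zero.1 hzero.symm)).symm

theorem eqOn_laurentCoeff_comp_zero (hS : IsBilateralWeightedShift e ω S)
    (hx : ∀ n ≤ m, laurentCoeff e ω n x = 0) (hz : r2Minus ω ≤ ‖z‖ₑ) {ε : ℝ} (hε : 0 < ε)
    {f : ℂ → H} (hf : AnalyticOnNhd ℂ f (Metric.ball z ε))
    (h : ∀ w ∈ Metric.ball z ε, S (f w) - w • f w = x) :
    Set.EqOn (fun w => laurentCoeff e ω m (f w)) 0 (Metric.ball z ε) := by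
  have hcl : z ∈ closure (Metric.closedBall (0 : ℂ) ‖z‖)ᶜ := by
    simp [closure_compl, interior_closedBall']
  obtain ⟨w₀, hw₀, hzw₀⟩ := mem_closure_iff.1 hcl _ Metric.isOpen_ball (Metric.mem_ball_self hε)
  have hev : (fun w => laurentCoeff e ω m (f w)) =ᶠ[𝓝 w₀] 0 := by
    filter_upwards [Metric.isOpen_ball.mem_nhds hw₀,
      Metric.isClosed_closedBall.isOpen_compl.mem_nhds hzw₀] with w hw hzw
    refine hS.laurentCoeff_eq_zero_of_r2Minus_lt hx (hz.trans_lt ?_) (h w hw)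
    simpa [← not_le, enorm_le_iff_norm_le] using hzw
  exact ((laurentCoeff e ω m).comp_analyticOnNhd hf).eqOn_zero_of_preconnected_of_eventuallyEq_zero
    (convex_ball z ε).isPreconnected hw₀ hev

theorem mem_localSpectrum (hS : IsBilateralWeightedShift e ω S) (hx : x ∈ HPlus e k) (hx0 : x ≠ 0)
    (hz2 : r2Minus ω ≤ ‖z‖ₑ) (hz3 : ‖z‖ₑ ≤ r3Plus ω) (hzR : ‖z‖ₑ ≤ RPlus e ω x) :
    z ∈ localSpectrum S x := by
  obtain ⟨m, hlow, hfirst⟩ := exists_first_laurentCoeff_ne_zero hS.weight_pos hx hx0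
  rintro ⟨U, ⟨hU, f, hf, h⟩, hzU⟩
  obtain ⟨ε, hε, hεU⟩ := Metric.isOpen_iff.1 hU z hzU
  have hzero := hS.eqOn_laurentCoeff_comp_zero hlow hz2 hε (hf.mono hεU) fun w hw => h w (hεU hw)
  refine hfirst ?_
  rcases eq_or_ne z 0 with rfl | hz
  · rw [← hS.laurentCoeff_sub_mul_laurentCoeff_add_one (h 0 hzU), zero_mul, sub_zero]
    exact hzero (Metric.mem_ball_self hε)
  have hcl : z ∈ closure (Metric.ball (0 : ℂ) ‖z‖) := by
    simp [closure_ball (0 : ℂ) (norm_ne_zero_iff.2 hz)]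
  have hopen : IsOpen (Metric.ball z ε ∩ {0}ᶜ) := Metric.isOpen_ball.inter isOpen_compl_singleton
  obtain ⟨w₀, hw₀, hw₀z⟩ := mem_closure_iff.1 hcl _ hopen ⟨Metric.mem_ball_self hε, hz⟩
  have hlt : ∀ w ∈ Metric.ball (0 : ℂ) ‖z‖, ‖w‖ₑ < ‖z‖ₑ := fun w hw => by
    simpa [← not_le, enorm_le_iff_norm_le] using hw
  refine laurentCoeff_eq_zero_of_tailSeries_eventuallyEq_zero hS.weight_pos
    ((hlt w₀ hw₀z).trans_le hzR) ?_
  filter_upwards [hopen.mem_nhds hw₀, Metric.isOpen_ball.mem_nhds hw₀z] with w ⟨hw, hw0⟩ hwz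
  rw [hS.tailSeries_sum_eq hw0 ((hlt w hwz).trans_le hz3) ((hlt w hwz).trans_le hzR) (h w (hεU hw))]
  exact hzero hw

end IsBilateralWeightedShift

theorem theorem4_general {H : Type*} [NormedAddCommGroup H] [InnerProductSpace ℂ H]
    [CompleteSpace H] (e : HilbertBasis ℤ ℂ H) (ω : ℤ → ℝ) (S : H →L[ℂ] H)
    (hS : IsBilateralWeightedShift e ω S)
    (k : ℤ) (x : H) (hx : x ∈ BilateralShift.HPlus e k) (hx0 : x ≠ 0) :
    (BilateralShift.r3Plus ω < BilateralShift.RPlus e ω x →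
      {z : ℂ | BilateralShift.r2Minus ω ≤ ‖z‖ₑ ∧ ‖z‖ₑ ≤ BilateralShift.r3Plus ω} ⊆
          localSpectrum S x ∧
        localSpectrum S x ⊆ {z : ℂ | ‖z‖ₑ ≤ BilateralShift.r3Plus ω}) ∧
    (BilateralShift.RPlus e ω x ≤ BilateralShift.r3Plus ω →
      {z : ℂ | BilateralShift.r2Minus ω ≤ ‖z‖ₑ ∧ ‖z‖ₑ ≤ BilateralShift.RPlus e ω x} ⊆
        localSpectrum S x) := by
  refine ⟨fun h => ⟨fun z hz => ?_, hS.localSpectrum_subset_of_r3Plus_lt_RPlus hx h⟩,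
    fun h z hz => ?_⟩
  · exact hS.mem_localSpectrum hx hx0 hz.1 hz.2 (hz.2.trans h.le)
  · exact hS.mem_localSpectrum hx hx0 hz.1 (hz.2.trans h) hz.2

theorem theorem4 {H : Type*} [NormedAddCommGroup H] [InnerProductSpace ℂ H] [CompleteSpace H]
    (e : HilbertBasis ℤ ℂ H) (ω : ℤ → ℝ) (S : H →L[ℂ] H)
    (hS : IsBilateralWeightedShift e ω S)
    (hr : BilateralShift.r2Minus ω = 0)
    (k : ℤ) (x : H) (hx : x ∈ BilateralShift.HPlus e k) (hx0 : x ≠ 0) :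
    (BilateralShift.r3Plus ω < BilateralShift.RPlus e ω x →
      localSpectrum S x = {z : ℂ | ‖z‖ₑ ≤ BilateralShift.r3Plus ω}) ∧
    (BilateralShift.RPlus e ω x ≤ BilateralShift.r3Plus ω →
      {z : ℂ | ‖z‖ₑ ≤ BilateralShift.RPlus e ω x} ⊆ localSpectrum S x) := by
  have hgen := theorem4_general e ω S hS k x hx hx0
  simp only [hr, zero_le, true_and] at hgen
  exact ⟨fun h => (hgen.1 h).2.antisymm (hgen.1 h).1, hgen.2⟩
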